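/- For integers $\ell,t\ge 1$, a $3$-uniform hypergraph is called a Berge theta hypergraph $\Theta^{B}_{\ell,t}$ if it consists of $t$ Berge paths of length $\ell$ joining two vertices, in the following sense: there are distinct vertices $x,\,y,\,v^{i}_{j}$ ($1\le i\le t$, $1\le j\le \ell-1$) such that, putting $v^i_0=x$ and $v^i_\ell=y$, its edges are $t\ell$ distinct $3$-element sets $e^{i}_{j}$ ($1\le i\le t$, $1\le j\le \ell$) with $\{v^{i}_{j-1},v^{i}_{j}\}\subset e^{i}_{j}$ for all $i,j$. (The third vertices of the edges are unrestricted; thus $\Theta^{B}_{\ell,t}$ denotes a family of hypergraphs.) A hypergraph is linear if any two distinct edges have at most one vertex in common. Let $\mathrm{ex}_3^{\mathrm{lin}}(n,\Theta^{B}_{\ell,t})$ be the maximum number of edges in a $3$-uniform linear hypergraph on $n$ vertices that contains no member of $\Theta^{B}_{\ell,t}$ as a subhypergraph. **Theorem.** $\mathrm{ex}_3^{\mathrm{lin}}(n,\Theta^{B}_{3,217})=\Theta(n^{4/3})$ as $n\to\infty$; that is, there are constants $c,C>0$ and $n_0$ such that $c\,n^{4/3}\le \mathrm{ex}_3^{\mathrm{lin}}(n,\Theta^{B}_{3,217})\le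 C\,n^{4/3}$ for all $n\ge n_0$. -/

import Mathlib

open Filter Asymptotics

namespace LinearTuran

/-- Every hyperedge has exactly `r` vertices. -/
def IsUniform {α : Type*} (H : Hypergraph α) (r : ℕ) : Prop :=
  ∀ e ∈ H.edgeSet, e.encard = r

/-- Any two distinct hyperedges have at most one vertex in common. -/
def IsLinear {α : Type*} (H : Hypergraph α) : Prop :=
  ∀ e ∈ H.edgeSet, ∀ f ∈ H.edgeSet, e ≠ f → (e ∩ f).encard ≤ 1

/-- `K` is a subhypergraph of `H`. -/
def IsSub {α : Type*} (K H : Hypergraph α) : Prop :=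
  K.vertexSet ⊆ H.vertexSet ∧ K.edgeSet ⊆ H.edgeSet

/-- `H` has no subhypergraph in the family `F` of forbidden hypergraphs. The family is given by its
members on the vertex type of `H`, so that a "copy" is literally a subhypergraph belonging to `F`
(the families used below are closed under isomorphism). -/
def IsFree {α : Type*} (F : Set (Hypergraph α)) (H : Hypergraph α) : Prop :=
  ∀ K ∈ F, ¬ IsSub K H

/-- The family of `r`-uniform Berge theta hypergraphs `Θ_{ℓ,t}^B` with vertices in `α`:
`t` Berge paths of length `ℓ` between two distinct vertices `x` and `y`. The `i`-th path has the
core vertices `x = v i 0, v i 1, …, v i ℓ = y` and the hyperedges `e i 0, …, e i (ℓ - 1)`,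
where `e i j` contains `v i j` and `v i (j + 1)`. All `2 + t (ℓ - 1)` core vertices are distinct
and all `t ℓ` hyperedges are distinct; nothing is required of the other vertices of the
hyperedges. -/
def bergeTheta (α : Type*) (r ℓ t : ℕ) : Set (Hypergraph α) :=
  {K | IsUniform K r ∧
    ∃ (x y : α) (v : Fin t → Fin (ℓ + 1) → α) (e : Fin t → Fin ℓ → Set α),
      x ≠ y ∧
      (∀ i, v i 0 = x) ∧
      (∀ i, v i (Fin.last ℓ) = y) ∧
      (∀ i i' j j', v i j = v i' j' → j = j' ∧ (i = i' ∨ j = 0 ∨ j = Fin.last ℓ)) ∧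
      (∀ i i' j j', e i j = e i' j' → i = i' ∧ j = j') ∧
      (∀ i j, v i j.castSucc ∈ e i j ∧ v i j.succ ∈ e i j) ∧
      K.edgeSet = {f | ∃ i j, f = e i j} ∧
      K.vertexSet = {x, y} ∪ ⋃₀ K.edgeSet}

/-- The linear Turán number `ex_r^lin(n, F)`: the maximum number of hyperedges in an `F`-free
`r`-uniform linear hypergraph on `n` vertices. The set below is finite, so the supremum of a
nonempty set is a maximum. -/
noncomputable def exLin (r n : ℕ) (F : Set (Hypergraph (Fin n))) : ℕ :=
  sSup {m : ℕ | ∃ H : Hypergraph (Fin n), H.vertexSet = Set.univ ∧ IsUniform H r ∧ IsLinear H ∧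
    IsFree F H ∧ H.edgeSet.ncard = m}

end LinearTuran

namespace LinearTuran

/-! Upper bound: choose two vertices in every hyperedge. By linearity different hyperedges give
different pairs, so a theta in the resulting graph expands to a Berge theta, and it suffices to
bound theta-free graphs (`card_darts_pow_three_le`). There one passes to a bipartite subgraph of
large minimum degree and explores three levels from a vertex. `card_edges_le_of_neighbors` shows
that edges near a neighbourhood are sparse, so the levels must grow, and minimum degree `d` forces
order `d ^ 3` vertices (`minDegree_pow_three_le`).

Lower bound: in three copies of `F ^ 3`, `F = ZMod p`, the hyperedges with vertices `w + l k • (a, a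
^ 2, a ^ 3)` number `p ^ 4` on `3 * p ^ 3` points. A path of length three between fixed ends through
prescribed parts gives three equations: the weighted power sums of degrees 1, 2, 3 of its three
directions are fixed. `card_le_four_of_walk` allows at most four such paths in a theta. The inner
vertices have at most nine choices of parts, so a theta has at most 36 paths and every `t > 36`
works. Bertrand's postulate then reaches all large `n`. -/

/-! ### Theta-free graphs. -/

open scoped Classical in
/-- Every finite graph, given by its set of darts, has a cut containing half of the darts. -/
theorem exists_cut {V : Type*} [Fintype V] (E : Finset (V × V)) (hE : ∀ p ∈ E, p.1 ≠ p.2) :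
    ∃ c : V → Bool, E.card ≤ 2 * (E.filter fun p => c p.1 ≠ c p.2).card := by
  have key : ∀ p ∈ E, 2 * (Finset.univ.filter fun c : V → Bool => c p.1 ≠ c p.2).card =
      Fintype.card (V → Bool) := by
    intro p hp
    have h : (Finset.univ.filter fun c : V → Bool => c p.1 ≠ c p.2).card =
        (Finset.univ.filter fun c : V → Bool => ¬ c p.1 ≠ c p.2).card := by
      -- Flipping the colour of `p.1` swaps the colourings that cut `p` with those that do not.
      refine Finset.card_bij' (fun c _ => Function.update c p.1 (!c p.1))
        (fun c _ => Function.update c p.1 (!c p.1)) ?_ ?_ ?_ ?_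
      · intro c hc
        have := (hE p hp).symm
        simp_all [Function.update_of_ne, Bool.eq_not_iff]
      · intro c hc
        have := (hE p hp).symm
        simp_all [Function.update_of_ne]
      · intro c _
        simp
      · intro c _
        simp
    have := Finset.card_filter_add_card_filter_not (s := (Finset.univ : Finset (V → Bool)))
      (fun c : V → Bool => c p.1 ≠ c p.2)
    rw [Finset.card_univ] at this
    omega
  by_contra! hcon
  have h1 : ∑ c : V → Bool, 2 * (E.filter fun p => c p.1 ≠ c p.2).card <
      ∑ _c : V → Bool, E.card :=
    Finset.sum_lt_sum_of_nonempty Finset.univ_nonempty fun c _ => hcon c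
  have h2 : ∑ c : V → Bool, 2 * (E.filter fun p => c p.1 ≠ c p.2).card =
      ∑ p ∈ E, 2 * (Finset.univ.filter fun c : V → Bool => c p.1 ≠ c p.2).card := by
    simp only [Finset.card_filter, ← Finset.mul_sum]
    rw [Finset.sum_comm]
  rw [h2, Finset.sum_congr rfl key] at h1
  simp [mul_comm] at h1

open scoped Classical in
/-- A graph with more than `2 * d * #S` darts inside `S` has a subgraph of minimum degree
more than `d`. -/
theorem exists_core {V : Type*} (R : V → V → Prop) [DecidableRel R] (hR : ∀ u v, R u v → R v u) (d : ℕ)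
    (S : Finset V) (hS : 2 * d * S.card < ∑ u ∈ S, (S.filter (R u)).card) :
    ∃ T ⊆ S, T.Nonempty ∧ ∀ u ∈ T, d < (T.filter (R u)).card := by
  induction S using Finset.strongInduction with
  | H S ih =>
    by_cases h : ∀ u ∈ S, d < (S.filter (R u)).card
    · refine ⟨S, subset_rfl, ?_, h⟩
      by_contra hne
      rw [Finset.not_nonempty_iff_eq_empty] at hne
      simp [hne] at hS
    · push Not at h
      obtain ⟨w, hw, hwd⟩ := h
      -- Deleting `w` loses at most `2 * d` darts, those out of `w` and those into `w`.
      have hlt : 2 * d * (S.erase w).card <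
          ∑ u ∈ S.erase w, ((S.erase w).filter (R u)).card := by
        have h1 : ∑ u ∈ S, (S.filter (R u)).card =
            (S.filter (R w)).card + ∑ u ∈ S.erase w, (S.filter (R u)).card :=
          (Finset.add_sum_erase S _ hw).symm
        have h2 : ∀ u ∈ S.erase w, (S.filter (R u)).card =
            ((S.erase w).filter (R u)).card + if R u w then 1 else 0 := by
          intro u _
          rw [← Finset.insert_erase hw, Finset.filter_insert]
          split_ifs with hu
          · rw [Finset.card_insert_of_notMem (by simp)]
            simp
          · simp
        have h3 : ∑ u ∈ S.erase w, (if R u w then 1 else 0) ≤ (S.filter (R w)).card := by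
          rw [← Finset.card_filter]
          refine Finset.card_le_card fun u hu => ?_
          simp only [Finset.mem_filter, Finset.mem_erase] at hu ⊢
          exact ⟨hu.1.2, hR _ _ hu.2⟩
        rw [Finset.sum_congr rfl h2, Finset.sum_add_distrib] at h1
        have h4 := Finset.card_erase_add_one hw
        rw [← h4] at hS
        nlinarith
      obtain ⟨T, hT, h⟩ := ih _ (Finset.erase_ssubset hw) hlt
      exact ⟨T, hT.trans (Finset.erase_subset _ _), h⟩

/-- The relation `R` contains `t` internally disjoint paths of length three between two vertices.
It is meant for bipartite relations, where the remaining core vertices differ automatically. -/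
def HasTheta {V : Type*} (R : V → V → Prop) (t : ℕ) : Prop :=
  ∃ (x y : V) (a b : Fin t → V), a.Injective ∧ b.Injective ∧
    ∀ i, R x (a i) ∧ R (a i) (b i) ∧ R (b i) y ∧ b i ≠ x ∧ a i ≠ y

open scoped Classical in
/-- In a bipartite graph without theta, there are few edges between a set `P` of neighbours of a
vertex `x` and a set `Q` avoiding `x`. -/
theorem card_edges_le_of_neighbors {V : Type*} (R : V → V → Prop) (hR : ∀ u v, R u v → R v u)
    (c : V → Bool) (hc : ∀ u v, R u v → c u ≠ c v) (t : ℕ) (ht : ¬ HasTheta R t)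
    (x : V) (P Q : Finset V) (hP : ∀ u ∈ P, R x u) (hQ : x ∉ Q) :
    ∑ u ∈ P, (Q.filter (R u)).card ≤ t * (P.card + Q.card) := by
  by_contra! hcon
  set Q' := Q.filter fun v => c v = c x with hQ'
  have hdisj : Disjoint P Q' := by
    rw [Finset.disjoint_left]
    intro u hu hu'
    exact hc _ _ (hP u hu) (Finset.mem_filter.1 hu').2.symm
  have hfilt : ∀ u ∈ P, Q.filter (R u) = Q'.filter (R u) := by
    intro u hu
    ext v
    simp only [hQ', Finset.mem_filter]
    constructor
    · rintro ⟨h1, h2⟩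
      refine ⟨⟨h1, ?_⟩, h2⟩
      have := hc _ _ (hP u hu)
      have := hc _ _ h2
      revert this
      revert this
      cases c x <;> cases c u <;> cases c v <;> simp
    · rintro ⟨h1, h2⟩
      exact ⟨h1.1, h2⟩
  -- Only edges between `P` and `Q'` are kept; each gives two darts, matching the factor 2 in
  -- `exists_core`.
  set R' : V → V → Prop := fun u v => R u v ∧ (u ∈ P ∧ v ∈ Q' ∨ u ∈ Q' ∧ v ∈ P) with hR'
  have hR'symm : ∀ u v, R' u v → R' v u := by
    rintro u v ⟨h1, h2⟩
    exact ⟨hR _ _ h1, by tauto⟩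
  have hsum : 2 * t * (P ∪ Q').card < ∑ u ∈ P ∪ Q', ((P ∪ Q').filter (R' u)).card := by
    rw [Finset.sum_union hdisj, Finset.card_union_of_disjoint hdisj]
    have h1 : ∑ u ∈ P, ((P ∪ Q').filter (R' u)).card = ∑ u ∈ P, (Q.filter (R u)).card := by
      refine Finset.sum_congr rfl fun u hu => ?_
      rw [hfilt u hu]
      congr 1
      ext v
      have := Finset.disjoint_left.1 hdisj hu
      simp only [hR', Finset.mem_filter, Finset.mem_union]
      tauto
    have h2 : ∑ u ∈ Q', ((P ∪ Q').filter (R' u)).card = ∑ u ∈ P, (Q.filter (R u)).card := by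
      rw [Finset.sum_congr rfl fun u hu => congrArg Finset.card (hfilt u hu)]
      refine Eq.trans ?_
        (Finset.sum_card_bipartiteAbove_eq_sum_card_bipartiteBelow (s := P) (t := Q') R).symm
      refine Finset.sum_congr rfl fun u hu => ?_
      congr 1
      ext v
      have := Finset.disjoint_right.1 hdisj hu
      have := hR u v
      have := hR v u
      simp only [hR', Finset.mem_filter, Finset.mem_union, Finset.bipartiteBelow]
      tauto
    have h3 : Q'.card ≤ Q.card := Finset.card_filter_le _ _
    rw [h1, h2]
    nlinarith
  obtain ⟨T, hT, ⟨w, hw⟩, hdeg⟩ := exists_core R' hR'symm t (P ∪ Q') hsum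
  obtain ⟨a, haT, haP⟩ : ∃ a ∈ T, a ∈ P := by
    obtain ⟨v, hv⟩ := Finset.card_pos.1 (lt_of_le_of_lt (Nat.zero_le _) (hdeg w hw))
    rw [Finset.mem_filter] at hv
    rcases hv.2.2 with h | h
    · exact ⟨w, hw, h.1⟩
    · exact ⟨v, hv.1, h.2⟩
  have hle : t ≤ (T.filter (R' a)).card := (hdeg a haT).le
  obtain ⟨Z, hZ, hZt⟩ := Finset.exists_subset_card_eq hle
  let z : Fin t → V := fun i => (Z.equivFinOfCardEq hZt).symm i
  have hz : z.Injective := fun i j h => by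
    simpa [z, Subtype.coe_injective.eq_iff] using h
  have hzT : ∀ i, z i ∈ T ∧ R' a (z i) := fun i =>
    Finset.mem_filter.1 (hZ ((Z.equivFinOfCardEq hZt).symm i).2)
  -- Every `z i` has at least `t` neighbours other than `a`, so Hall's condition is immediate; the
  -- paths will be `x, f i, z i, a`.
  have hall : ∀ s : Finset (Fin t),
      s.card ≤ (s.biUnion fun i => (T.filter (R' (z i))).erase a).card := by
    intro s
    rcases s.eq_empty_or_nonempty with rfl | ⟨i, hi⟩
    · simp
    · have h1 : s.card ≤ t := by simpa using Finset.card_le_univ s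
      have h2 := hdeg _ (hzT i).1
      have h3 : (T.filter (R' (z i))).card - 1 ≤ ((T.filter (R' (z i))).erase a).card :=
        Finset.pred_card_le_card_erase
      have h4 := Finset.card_le_card
        (Finset.subset_biUnion_of_mem (fun i => (T.filter (R' (z i))).erase a) hi)
      omega
  obtain ⟨f, hf, hfm⟩ := (Finset.all_card_le_biUnion_card_iff_exists_injective _).1 hall
  refine ht ⟨x, a, f, z, hf, hz, fun i => ?_⟩
  have h1 := hfm i
  simp only [Finset.mem_erase, Finset.mem_filter] at h1
  have h2 : z i ∈ Q' := by
    rcases (hzT i).2.2 with h | h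
    · exact h.2
    · exact absurd h.1 (Finset.disjoint_left.1 hdisj haP)
  have h3 : f i ∈ P := by
    rcases h1.2.2.2 with h | h
    · exact absurd h2 (Finset.disjoint_left.1 hdisj h.1)
    · exact h.2
  refine ⟨hP _ h3, hR _ _ h1.2.2.1, hR _ _ (hzT i).2.1, ?_, h1.1⟩
  rintro rfl
  exact hQ (Finset.mem_filter.1 h2).1

open scoped Classical in
/-- A bipartite graph without theta and with minimum degree at least `d` has on the order of
`d ^ 3` vertices. -/
theorem minDegree_pow_three_le {V : Type*} (R : V → V → Prop) (hR : ∀ u v, R u v → R v u)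
    (c : V → Bool) (hc : ∀ u v, R u v → c u ≠ c v) (t : ℕ) (ht : ¬ HasTheta R t)
    (S : Finset V) (hS : S.Nonempty) (d : ℕ) (hd : ∀ u ∈ S, d ≤ (S.filter (R u)).card) :
    d ^ 3 ≤ (6 * t + 2) ^ 3 * S.card := by
  obtain ⟨x, hx⟩ := hS
  set L₁ := S.filter (R x) with hL₁
  set L₂ := S.filter fun v => v ≠ x ∧ ∃ a ∈ L₁, R a v with hL₂
  set L₃ := S.filter fun v => v ∉ L₁ ∧ ∃ b ∈ L₂, R b v with hL₃
  have hpar : ∀ b, ∃ a, b ∈ L₂ → a ∈ L₁ ∧ R a b := by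
    intro b
    by_cases hb : b ∈ L₂
    · obtain ⟨-, -, a, ha⟩ := Finset.mem_filter.1 hb
      exact ⟨a, fun _ => ha⟩
    · exact ⟨b, fun h => absurd h hb⟩
  -- `π` picks a parent in `L₁`. The children of one parent lie in its neighbourhood, so the
  -- sparsity bound applies to each class separately.
  choose π hπ using hpar
  have mem₁ : ∀ {a}, a ∈ L₁ ↔ a ∈ S ∧ R x a := by simp [hL₁]
  have hxL₂ : x ∉ L₂ := by simp [hL₂]
  let ch : V → Finset V := fun a => L₂.filter fun b => π b = a
  let N : V → Finset V := fun a => L₃.filter fun y => ∃ b ∈ ch a, R b y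
  have mem_ch : ∀ {a b}, b ∈ ch a ↔ b ∈ L₂ ∧ π b = a := by simp [ch]
  have hE₁ := card_edges_le_of_neighbors R hR c hc t ht x L₁ L₂ (fun u hu => (mem₁.1 hu).2) hxL₂
  have hA : d ≤ L₁.card := hd x hx
  have h₁ : d * L₁.card ≤ ∑ u ∈ L₁, (L₂.filter (R u)).card + L₁.card := by
    have : ∀ u ∈ L₁, d ≤ (L₂.filter (R u)).card + 1 := by
      intro u hu
      refine (hd u (mem₁.1 hu).1).trans ((Finset.card_le_card ?_).trans
        (Finset.card_insert_le x _))
      intro v hv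
      rw [Finset.mem_filter] at hv
      rw [Finset.mem_insert, Finset.mem_filter, hL₂, Finset.mem_filter]
      by_cases hvx : v = x
      · exact Or.inl hvx
      · exact Or.inr ⟨⟨hv.1, hvx, u, hu, hv.2⟩, hv.2⟩
    have := Finset.sum_le_sum this
    rw [Finset.sum_add_distrib] at this
    simpa [mul_comm] using this
  have h₂ : d * L₂.card ≤ ∑ u ∈ L₁, (L₂.filter (R u)).card +
      ∑ b ∈ L₂, (L₃.filter (R b)).card := by
    have : ∀ b ∈ L₂, d ≤ (L₁.filter (R b)).card + (L₃.filter (R b)).card := by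
      intro b hb
      refine (hd b (Finset.mem_filter.1 hb).1).trans ((Finset.card_le_card ?_).trans
        (Finset.card_union_le _ _))
      intro v hv
      rw [Finset.mem_filter] at hv
      by_cases hv₁ : v ∈ L₁
      · exact Finset.mem_union_left _ (Finset.mem_filter.2 ⟨hv₁, hv.2⟩)
      · exact Finset.mem_union_right _
          (Finset.mem_filter.2 ⟨Finset.mem_filter.2 ⟨hv.1, hv₁, b, hb, hv.2⟩, hv.2⟩)
    have := Finset.sum_le_sum this
    rw [Finset.sum_add_distrib] at this
    have hdc : ∑ u ∈ L₁, (L₂.filter (R u)).card = ∑ b ∈ L₂, (L₁.filter (R b)).card := by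
      refine (Finset.sum_card_bipartiteAbove_eq_sum_card_bipartiteBelow (s := L₁) (t := L₂) R).trans
        (Finset.sum_congr rfl fun b _ => ?_)
      congr 1
      ext v
      simp only [Finset.bipartiteBelow, Finset.mem_filter]
      exact and_congr_right fun _ => ⟨hR _ _, hR _ _⟩
    rw [hdc]
    simpa [mul_comm] using this
  have h₃ : ∑ b ∈ L₂, (L₃.filter (R b)).card ≤ ∑ a ∈ L₁, t * ((ch a).card + (N a).card) := by
    rw [← Finset.sum_fiberwise_of_maps_to (s := L₂) (t := L₁) (g := π) fun b hb => (hπ b hb).1]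
    refine Finset.sum_le_sum fun a ha => ?_
    have h := card_edges_le_of_neighbors R hR c hc t ht a (ch a) (N a)
      (fun b hb => by
        obtain ⟨hb₁, hb₂⟩ := mem_ch.1 hb
        rw [← hb₂]
        exact (hπ b hb₁).2)
      (fun h => by
        have := (Finset.mem_filter.1 (Finset.mem_filter.1 h).1).2.1
        exact this ha)
    refine le_trans (le_of_eq (Finset.sum_congr rfl fun b hb => ?_)) h
    congr 1
    ext y
    simp only [N, Finset.mem_filter]
    exact ⟨fun h => ⟨⟨h.1, b, hb, h.2⟩, h.2⟩, fun h => ⟨h.1.1, h.2⟩⟩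
  have h₄ : ∑ a ∈ L₁, (ch a).card = L₂.card :=
    (Finset.card_eq_sum_card_fiberwise fun b hb => (hπ b hb).1).symm
  -- A vertex of `L₃` adjacent to children of more than `t` parents would form a theta with `x`:
  -- distinct parents force distinct children.
  have h₅ : ∑ a ∈ L₁, (N a).card ≤ t * L₃.card := by
    have hy : ∀ y ∈ L₃, (L₁.filter fun a => ∃ b ∈ ch a, R b y).card ≤ t := by
      intro y hy
      by_contra! hcon
      obtain ⟨Z, hZ, hZt⟩ := Finset.exists_subset_card_eq hcon.le
      let a : Fin t → V := fun i => (Z.equivFinOfCardEq hZt).symm i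
      have ha : a.Injective := fun i j h => by
        simpa [a, Subtype.coe_injective.eq_iff] using h
      have haZ : ∀ i, a i ∈ L₁ ∧ ∃ b ∈ ch (a i), R b y := fun i =>
        Finset.mem_filter.1 (hZ ((Z.equivFinOfCardEq hZt).symm i).2)
      choose ha₁ b hb hby using haZ
      refine ht ⟨x, y, a, b, ha, fun i j hij => ha ?_, fun i => ⟨(mem₁.1 (ha₁ i)).2, ?_, hby i,
        ?_, ?_⟩⟩
      · rw [← (mem_ch.1 (hb i)).2, ← (mem_ch.1 (hb j)).2, hij]
      · have := (hπ (b i) (mem_ch.1 (hb i)).1).2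
        rwa [(mem_ch.1 (hb i)).2] at this
      · intro h
        exact hxL₂ (h ▸ (mem_ch.1 (hb i)).1)
      · intro h
        exact (Finset.mem_filter.1 hy).2.1 (h ▸ ha₁ i)
    calc ∑ a ∈ L₁, (N a).card
        = ∑ y ∈ L₃, (L₁.filter fun a => ∃ b ∈ ch a, R b y).card :=
          Finset.sum_card_bipartiteAbove_eq_sum_card_bipartiteBelow _
      _ ≤ ∑ y ∈ L₃, t := Finset.sum_le_sum hy
      _ = t * L₃.card := by simp [mul_comm]
  have h₆ : L₃.card ≤ S.card := Finset.card_filter_le _ _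
  rw [← Finset.mul_sum, Finset.sum_add_distrib, h₄] at h₃
  have hpos : 1 ≤ S.card := Finset.card_pos.2 ⟨x, hx⟩
  generalize L₁.card = A at *
  generalize L₂.card = B at *
  generalize L₃.card = C at *
  generalize S.card = n at *
  -- For small `d`, nonemptiness of `S` suffices. Otherwise `d` is large enough to absorb the
  -- multiples of `A` and `B` on the right of `e₁` and `e₂`.
  rcases le_total d (6 * t + 2) with hdt | hdt
  · calc d ^ 3 ≤ (6 * t + 2) ^ 3 * 1 := by rw [mul_one]; gcongr
      _ ≤ _ := by gcongr
  · have hC : t * (t * C) ≤ t * (t * n) := by gcongr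
    have hN : t * (B + ∑ a ∈ L₁, (N a).card) ≤ t * (B + t * C) := by gcongr
    have e₁ : d * A ≤ t * (A + B) + A := by omega
    have e₂ : d * B ≤ t * (A + B) + t * (B + t * C) := by omega
    have f₁ : d * d ≤ 2 * (t * B) := by nlinarith
    have f₂ : t * A ≤ t * B := by nlinarith
    have f₃ : d * B ≤ 2 * (t * (t * n)) := by nlinarith
    calc d ^ 3 = d * d * d := by ring
      _ ≤ 2 * (t * B) * d := by gcongr
      _ = 2 * t * (d * B) := by ring
      _ ≤ 2 * t * (2 * (t * (t * n))) := by gcongr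
      _ = 4 * t ^ 3 * n := by ring
      _ ≤ (6 * t + 2) ^ 3 * n := by
        gcongr
        nlinarith [Nat.zero_le (t ^ 3), Nat.zero_le (t ^ 2)]

/-- The relation `R` contains `t` internally disjoint paths of length three between two distinct
vertices. -/
def HasProperTheta {V : Type*} (R : V → V → Prop) (t : ℕ) : Prop :=
  ∃ (x y : V) (a b : Fin t → V), x ≠ y ∧ a.Injective ∧ b.Injective ∧ (∀ i j, a i ≠ b j) ∧
    ∀ i, R x (a i) ∧ R (a i) (b i) ∧ R (b i) y ∧ b i ≠ x ∧ a i ≠ y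

/-- A path of length three joins opposite colours, so `x ≠ y`, and each `b i` has the colour of `x`
while no `a i` does. -/
theorem HasTheta.hasProperTheta {V : Type*} {R : V → V → Prop} {c : V → Bool}
    (hc : ∀ u v, R u v → c u ≠ c v) {t : ℕ} (ht : 0 < t) (h : HasTheta R t) :
    HasProperTheta R t := by
  obtain ⟨x, y, a, b, ha, hb, hp⟩ := h
  have hcol : ∀ i, c (a i) ≠ c x ∧ c (b i) = c x ∧ c y ≠ c x := by
    intro i
    have h₁ := hc _ _ (hp i).1
    have h₂ := hc _ _ (hp i).2.1
    have h₃ := hc _ _ (hp i).2.2.1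
    revert h₁ h₂ h₃
    cases c x <;> cases c (a i) <;> cases c (b i) <;> cases c y <;> simp
  refine ⟨x, y, a, b, fun h => (hcol ⟨0, ht⟩).2.2 (h ▸ rfl), ha, hb, fun i j h => ?_, hp⟩
  exact (hcol i).1 (h ▸ (hcol j).2.1)

theorem HasProperTheta.mono {V : Type*} {R R' : V → V → Prop} {t : ℕ}
    (h : ∀ u v, R u v → R' u v) : HasProperTheta R t → HasProperTheta R' t := by
  rintro ⟨x, y, a, b, hxy, ha, hb, hab, hp⟩
  exact ⟨x, y, a, b, hxy, ha, hb, hab, fun i => ⟨h _ _ (hp i).1, h _ _ (hp i).2.1,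
    h _ _ (hp i).2.2.1, (hp i).2.2.2⟩⟩

open scoped Classical in
/-- The Faudree–Simonovits bound for theta graphs with paths of length three. -/
theorem card_darts_pow_three_le {V : Type*} [Fintype V] (R : V → V → Prop) [DecidableRel R]
    (hR : ∀ u v, R u v → R v u) (hirr : ∀ u, ¬ R u u) {t : ℕ} (ht : 0 < t)
    (hfree : ¬ HasProperTheta R t) :
    (Finset.univ.filter fun p : V × V => R p.1 p.2).card ^ 3 ≤
      64 * (6 * t + 2) ^ 3 * Fintype.card V ^ 4 := by
  set E := Finset.univ.filter fun p : V × V => R p.1 p.2 with hE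
  obtain ⟨c, hcut⟩ := exists_cut E fun p hp h => by
    rw [hE, Finset.mem_filter] at hp
    exact hirr p.1 (by simpa [← h] using hp.2)
  let R' : V → V → Prop := fun u v => R u v ∧ c u ≠ c v
  have hR' : ∀ u v, R' u v → R' v u := fun u v h => ⟨hR _ _ h.1, h.2.symm⟩
  have hfree' : ¬ HasTheta R' t := fun h =>
    hfree ((h.hasProperTheta (fun _ _ h => h.2) ht).mono fun _ _ h => h.1)
  have hcount : (E.filter fun p => c p.1 ≠ c p.2).card =
      ∑ u : V, (Finset.univ.filter (R' u)).card := by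
    simp only [hE, Finset.filter_filter, Finset.card_filter]
    exact Fintype.sum_prod_type _
  rw [hcount] at hcut
  set M := ∑ u : V, (Finset.univ.filter (R' u)).card with hM
  set n := Fintype.card V with hn
  rcases Nat.eq_zero_or_pos M with h0 | h0
  · have : E.card = 0 := by omega
    simp [this]
  have hn0 : 0 < n := by
    rw [hn, Fintype.card_pos_iff]
    by_contra h
    rw [not_nonempty_iff] at h
    simp [hM] at h0
  have h₁ := Nat.div_mul_le_self (M - 1) (2 * n)
  have h₂ := Nat.lt_div_mul_add (a := M - 1) (b := 2 * n) (by omega)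
  -- The `- 1` gives the strict `2 * d * n < M` that `exists_core` needs, and still `M ≤ 2 * n * (d
  -- + 1)`.
  set d := (M - 1) / (2 * n) with hd
  obtain ⟨T, -, hT, hdeg⟩ := exists_core R' hR' d Finset.univ (by
    rw [Finset.card_univ, ← hn, ← hM]
    have : 2 * d * n = d * (2 * n) := by ring
    omega)
  have h₃ := minDegree_pow_three_le R' hR' c (fun _ _ h => h.2) t hfree' T hT (d + 1)
    fun u hu => Nat.succ_le_of_lt (by convert hdeg u hu)
  have h₄ : T.card ≤ n := Finset.card_le_univ T
  have h₅ : E.card ≤ 4 * n * (d + 1) := by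
    have : 4 * n * (d + 1) = 2 * (d * (2 * n) + 2 * n) := by ring
    omega
  calc E.card ^ 3 ≤ (4 * n * (d + 1)) ^ 3 := by gcongr
    _ = 64 * n ^ 3 * (d + 1) ^ 3 := by ring
    _ ≤ 64 * n ^ 3 * ((6 * t + 2) ^ 3 * n) := by
      gcongr
      exact h₃.trans (by gcongr)
    _ = _ := by ring

/-! ### From graphs to linear hypergraphs. -/

theorem theta_core_injective {V : Type*} {t : ℕ} {x y : V} {a b : Fin t → V} (hxy : x ≠ y)
    (ha : a.Injective) (hb : b.Injective) (hab : ∀ i j, a i ≠ b j) (hax : ∀ i, a i ≠ x)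
    (hbx : ∀ i, b i ≠ x) (hay : ∀ i, a i ≠ y) (hby : ∀ i, b i ≠ y) (i i' : Fin t) (j j' : Fin 4)
    (h : (![x, a i, b i, y] : Fin 4 → V) j = (![x, a i', b i', y] : Fin 4 → V) j') :
    j = j' ∧ (i = i' ∨ j = 0 ∨ j = Fin.last 3) := by
  have ha' := @ha i i'
  have hb' := @hb i i'
  match j, j', h with
  | 0, 0, _ => simp
  | 0, 1, h => exact absurd h.symm (hax i')
  | 0, 2, h => exact absurd h.symm (hbx i')
  | 0, 3, h => exact absurd h hxy
  | 1, 0, h => exact absurd h (hax i)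
  | 1, 1, h => exact ⟨rfl, Or.inl (ha' h)⟩
  | 1, 2, h => exact absurd h (hab i i')
  | 1, 3, h => exact absurd h (hay i)
  | 2, 0, h => exact absurd h (hbx i)
  | 2, 1, h => exact absurd h.symm (hab i' i)
  | 2, 2, h => exact ⟨rfl, Or.inl (hb' h)⟩
  | 2, 3, h => exact absurd h (hby i)
  | 3, 0, h => exact absurd h.symm hxy
  | 3, 1, h => exact absurd h.symm (hay i')
  | 3, 2, h => exact absurd h.symm (hby i')
  | 3, 3, _ => exact ⟨rfl, Or.inr (Or.inr rfl)⟩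

open scoped Classical in
/-- A linear `3`-uniform hypergraph on `n` vertices without Berge thetas with paths of length
three has `O(n ^ (4 / 3))` hyperedges. -/
theorem ncard_edgeSet_pow_three_le {n : ℕ} {t : ℕ} (ht : 0 < t) (H : Hypergraph (Fin n))
    (hu : IsUniform H 3) (hl : IsLinear H) (hf : IsFree (bergeTheta (Fin n) 3 3 t) H) :
    H.edgeSet.ncard ^ 3 ≤ 64 * (6 * t + 2) ^ 3 * n ^ 4 := by
  have hpair : ∀ e : H.edgeSet, ∃ p : Fin n × Fin n, p.1 ∈ e.1 ∧ p.2 ∈ e.1 ∧ p.1 ≠ p.2 := by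
    intro e
    obtain ⟨u, v, hu, hv, huv⟩ := Set.one_lt_encard_iff.1 (by rw [hu e e.2]; norm_num)
    exact ⟨(u, v), hu, hv, huv⟩
  choose p hp₁ hp₂ hp using hpair
  have hlin : ∀ e ∈ H.edgeSet, ∀ f ∈ H.edgeSet, ∀ u v, u ≠ v → u ∈ e → v ∈ e → u ∈ f → v ∈ f →
      e = f := by
    intro e he f hf u v huv hue hve huf hvf
    by_contra hne
    exact absurd (hl e he f hf hne)
      (not_le.2 (Set.one_lt_encard_iff.2 ⟨u, v, ⟨hue, huf⟩, ⟨hve, hvf⟩, huv⟩))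
  let R : Fin n → Fin n → Prop := fun u v => ∃ e, s((p e).1, (p e).2) = s(u, v)
  have hirr : ∀ u, ¬ R u u := fun u ⟨e, he⟩ => hp e (by
    rcases Sym2.eq_iff.1 he with ⟨h₁, h₂⟩ | ⟨h₁, h₂⟩ <;> rw [h₁, h₂])
  have hmem : ∀ e u v, s((p e).1, (p e).2) = s(u, v) → u ∈ e.1 ∧ v ∈ e.1 := by
    intro e u v h
    rcases Sym2.eq_iff.1 h with ⟨h₁, h₂⟩ | ⟨h₁, h₂⟩ <;> rw [← h₁, ← h₂]
    · exact ⟨hp₁ e, hp₂ e⟩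
    · exact ⟨hp₂ e, hp₁ e⟩
  have hinj : p.Injective := by
    intro e f h
    exact Subtype.ext (hlin e e.2 f f.2 (p e).1 (p e).2 (hp e) (hp₁ e) (hp₂ e) (h ▸ hp₁ f)
      (h ▸ hp₂ f))
  have hcard : H.edgeSet.ncard ≤
      (Finset.univ.filter fun q : Fin n × Fin n => R q.1 q.2).card := by
    rw [← Nat.card_coe_set_eq, Nat.card_eq_fintype_card, ← Finset.card_univ]
    exact Finset.card_le_card_of_injOn p (fun e _ =>
      Finset.mem_coe.2 (Finset.mem_filter.2 ⟨Finset.mem_univ _, e, rfl⟩))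
      hinj.injOn
  have hfree : ¬ HasProperTheta R t := by
    rintro ⟨x, y, a, b, hxy, ha, hb, hab, hpath⟩
    let v : Fin t → Fin 4 → Fin n := fun i => ![x, a i, b i, y]
    have hv : ∀ i i' j j', v i j = v i' j' → j = j' ∧ (i = i' ∨ j = 0 ∨ j = Fin.last 3) :=
      theta_core_injective hxy ha hb hab (fun i h => hirr x (by have := (hpath i).1; rwa [h] at this))
        (fun i => (hpath i).2.2.2.1) (fun i => (hpath i).2.2.2.2)
        (fun i h => hirr y (by have := (hpath i).2.2.1; rwa [h] at this))
    have hR : ∀ i (j : Fin 3), R (v i j.castSucc) (v i j.succ) := by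
      intro i j
      obtain ⟨h₁, h₂, h₃, -⟩ := hpath i
      fin_cases j
      · exact h₁
      · exact h₂
      · exact h₃
    choose e he using hR
    have hxe : ∀ i j, v i (Fin.castSucc j) ∈ (e i j).1 ∧ v i j.succ ∈ (e i j).1 :=
      fun i j => hmem _ _ _ (he i j)
    let K : Hypergraph (Fin n) :=
      { vertexSet := {x, y} ∪ ⋃₀ {f | ∃ i j, f = (e i j).1}
        edgeSet := {f | ∃ i j, f = (e i j).1}
        subset_vertexSet_of_mem_edgeSet' := fun f hf =>
          (Set.subset_sUnion_of_mem hf).trans Set.subset_union_right }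
    have hKH : K.edgeSet ⊆ H.edgeSet := by
      rintro f ⟨i, j, rfl⟩
      exact (e i j).2
    refine hf K ⟨fun f hf => hu f (hKH hf), x, y, v, fun i j => (e i j).1, hxy, fun i => rfl,
      fun i => rfl, hv, ?_, hxe, rfl, rfl⟩ ⟨?_, hKH⟩
    -- Equal hyperedges have the same chosen pair. Read in the same order, it lies on one path,
    -- since no single step joins `x` to `y`; read in reverse, it would need `j = j' + 1` and `j' =
    -- j + 1`.
    · intro i i' j j' h
      have h' := he i j
      rw [Subtype.ext h, he i' j'] at h'
      rcases Sym2.eq_iff.1 h' with ⟨h₁, h₂⟩ | ⟨h₁, h₂⟩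
      · obtain ⟨h₃, h₄⟩ := hv _ _ _ _ h₁
        obtain ⟨-, h₅⟩ := hv _ _ _ _ h₂
        simp only [Fin.ext_iff, Fin.val_castSucc, Fin.val_succ, Fin.val_last, Fin.val_zero]
          at h₃ h₄ h₅ ⊢
        omega
      · have h₃ := (hv _ _ _ _ h₁).1
        have h₄ := (hv _ _ _ _ h₂).1
        simp only [Fin.ext_iff, Fin.val_castSucc, Fin.val_succ] at h₃ h₄
        omega
    · have hxy' : ({x, y} : Set (Fin n)) ⊆ H.vertexSet := by
        rintro z (rfl | rfl)
        · exact H.subset_vertexSet_of_mem_edgeSet' (e ⟨0, ht⟩ 0).2 (hxe ⟨0, ht⟩ 0).1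
        · exact H.subset_vertexSet_of_mem_edgeSet' (e ⟨0, ht⟩ 2).2 (hxe ⟨0, ht⟩ 2).2
      refine Set.union_subset hxy' (Set.sUnion_subset fun f hf => ?_)
      exact H.subset_vertexSet_of_mem_edgeSet' (hKH hf)
  have h := card_darts_pow_three_le R (fun u v ⟨e, he⟩ => ⟨e, he.trans Sym2.eq_swap⟩)
    hirr ht hfree
  rw [Fintype.card_fin] at h
  exact (Nat.pow_le_pow_left hcard 3).trans h

/-! ### Weighted power sums of three nodes. -/

section PowerSums

variable {F ι : Type*} [Field F]

theorem card_le_four_of_quartic (I : Finset ι) (f : ι → F)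
    (hf : Set.InjOn f I) (a b c d e : F) (hac : a ≠ 0 ∨ c ≠ 0)
    (h : ∀ i ∈ I, a * f i ^ 4 + b * f i ^ 3 + c * f i ^ 2 + d * f i + e = 0) : I.card ≤ 4 := by
  classical
  let P : Polynomial F := .C a * .X ^ 4 + .C b * .X ^ 3 + .C c * .X ^ 2 + .C d * .X + .C e
  have hP : P ≠ 0 := by
    intro h0
    have h4 : P.coeff 4 = a := by simp [P]
    have h2 : P.coeff 2 = c := by simp [P]
    rw [h0, Polynomial.coeff_zero] at h4 h2
    exact hac.elim (fun h => h h4.symm) (fun h => h h2.symm)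
  have hdeg : P.natDegree ≤ 4 := by
    simp only [P]
    compute_degree
  rw [← Finset.card_image_of_injOn hf]
  refine le_trans (Finset.card_le_card (t := P.roots.toFinset) fun x hx => ?_)
    ((Multiset.toFinset_card_le _).trans ((Polynomial.card_roots' P).trans hdeg))
  obtain ⟨i, hi, rfl⟩ := Finset.mem_image.1 hx
  rw [Multiset.mem_toFinset, Polynomial.mem_roots hP]
  simpa [P, Polynomial.IsRoot] using h i hi

/-- For `u = p - c₁` and `v = r - c₁` the first two equations fix `u * v = (q - r) * (q - p) ≠ 0`.
The third then fixes `u + v`, so `u` is a root of a quadratic. -/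
theorem card_le_four_alternating (I : Finset ι) (p q r : ι → F) (c₁ c₂ c₃ : F)
    (h2 : (2 : F) ≠ 0) (h3 : (3 : F) ≠ 0) (hp : Set.InjOn p I)
    (hpq : ∀ i ∈ I, p i ≠ q i) (hqr : ∀ i ∈ I, q i ≠ r i)
    (e₁ : ∀ i ∈ I, p i - q i + r i = c₁) (e₂ : ∀ i ∈ I, p i ^ 2 - q i ^ 2 + r i ^ 2 = c₂)
    (e₃ : ∀ i ∈ I, p i ^ 3 - q i ^ 3 + r i ^ 3 = c₃) : I.card ≤ 4 := by
  rcases I.eq_empty_or_nonempty with rfl | ⟨j, hj⟩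
  · simp
  set k := (c₁ ^ 2 - c₂) / 2 with hk
  have hk' : 2 * k = c₁ ^ 2 - c₂ := by rw [hk]; field_simp
  have hprod : ∀ i ∈ I, (p i - c₁) * (r i - c₁) = k := by
    intro i hi
    apply mul_left_cancel₀ h2
    rw [hk', ← e₁ i hi, ← e₂ i hi]
    ring
  have hk0 : k ≠ 0 := by
    rw [← hprod j hj, ← e₁ j hj]
    refine mul_ne_zero ?_ ?_
    · have := sub_ne_zero.2 (hqr j hj)
      convert this using 1
      ring
    · have := sub_ne_zero.2 (hpq j hj).symm
      convert this using 1
      ring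
  refine card_le_four_of_quartic I (fun i => p i - c₁) (fun i hi j hj h => hp hi hj (by simpa using h))
    0 0 (3 * k) (-(c₁ ^ 3 - 6 * c₁ * k - c₃)) (3 * k ^ 2) (Or.inr (mul_ne_zero h3 hk0)) ?_
  intro i hi
  have h := hprod i hi
  have hq : q i = p i + r i - c₁ := by linear_combination -e₁ i hi
  have h' := e₃ i hi
  rw [hq] at h'
  rw [← h, ← h']
  ring

/-- The weights sum to `δ ≠ 0`, so a translation makes `c₁ = 0`. Then `q = p + δ * r`, the second
equation expresses `p * r` through `r ^ 2`, and the third, times `-4 * r`, becomes a quartic in `r`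
with leading coefficient `δ * (δ ^ 2 - 1)`. -/
theorem card_le_four_of_sum_ne_zero (I : Finset ι) (p q r : ι → F) (δ c₁ c₂ c₃ : F)
    (hδ : δ ≠ 0) (hδ1 : δ ≠ 1) (hδ1' : δ ≠ -1) (hr : Set.InjOn r I)
    (hpq : ∀ i ∈ I, p i ≠ q i)
    (e₁ : ∀ i ∈ I, p i - q i + δ * r i = c₁)
    (e₂ : ∀ i ∈ I, p i ^ 2 - q i ^ 2 + δ * r i ^ 2 = c₂)
    (e₃ : ∀ i ∈ I, p i ^ 3 - q i ^ 3 + δ * r i ^ 3 = c₃) : I.card ≤ 4 := by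
  wlog hc : c₁ = 0 generalizing p q r c₁ c₂ c₃
  · obtain ⟨s, hs⟩ : ∃ s, δ * s = c₁ := ⟨c₁ / δ, by field_simp⟩
    refine this (fun i => p i - s) (fun i => q i - s) (fun i => r i - s) 0
      (c₂ - 2 * s * c₁ + δ * s ^ 2) (c₃ - 3 * s * c₂ + 3 * s ^ 2 * c₁ - δ * s ^ 3)
      (fun i hi j hj h => hr hi hj (by simpa using h)) (fun i hi h => hpq i hi (by simpa using h))
      ?_ ?_ ?_ rfl
    · intro i hi
      linear_combination e₁ i hi - hs
    · intro i hi
      linear_combination e₂ i hi - 2 * s * e₁ i hi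
    · intro i hi
      linear_combination e₃ i hi - 3 * s * e₂ i hi + 3 * s ^ 2 * e₁ i hi
  subst hc
  obtain ⟨e, he⟩ : ∃ e, δ * e = -c₂ := ⟨-c₂ / δ, by field_simp⟩
  refine card_le_four_of_quartic I r hr (δ * (δ ^ 2 - 1)) 0 (6 * e * δ) (4 * c₃) (3 * e ^ 2 * δ)
    (Or.inl (mul_ne_zero hδ ?_)) ?_
  · rw [show δ ^ 2 - 1 = (δ - 1) * (δ + 1) by ring]
    exact mul_ne_zero (sub_ne_zero.2 hδ1) (by rwa [Ne, ← eq_neg_iff_add_eq_zero])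
  · intro i hi
    have hq : q i = p i + δ * r i := by linear_combination -e₁ i hi
    have h₂ := e₂ i hi
    have h₃ := e₃ i hi
    rw [hq] at h₂ h₃
    have h₄ : e = 2 * p i * r i - (1 - δ) * r i ^ 2 := by
      apply mul_left_cancel₀ hδ
      linear_combination he + h₂
    rw [h₄, ← h₃]
    ring

/-- The first sum is translation invariant, so `c₁` cannot be normalised; the differences `u = p -
q`, `v = r - q` are used instead, and `u` gives `v`. If `c₁ ≠ 0`, the second equation is linear in
`q`, and substitution into the third leaves a quartic in `u`. If `c₁ = 0`, the second fixes `u ^ 2`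
and the third is linear in `q`. Either way `u` determines `q`, hence `p`. -/
theorem card_le_four_of_sum_eq_zero (I : Finset ι) (p q r : ι → F) (α β γ c₁ c₂ c₃ : F)
    (h2 : (2 : F) ≠ 0) (h3 : (3 : F) ≠ 0) (hα : α ≠ 0) (hβ : β ≠ 0) (hγ : γ ≠ 0)
    (hsum : α + β + γ = 0) (hp : Set.InjOn p I) (hpq : ∀ i ∈ I, p i ≠ q i)
    (e₁ : ∀ i ∈ I, α * p i + β * q i + γ * r i = c₁)
    (e₂ : ∀ i ∈ I, α * p i ^ 2 + β * q i ^ 2 + γ * r i ^ 2 = c₂)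
    (e₃ : ∀ i ∈ I, α * p i ^ 3 + β * q i ^ 3 + γ * r i ^ 3 = c₃) : I.card ≤ 4 := by
  rcases I.eq_empty_or_nonempty with rfl | ⟨j, hj⟩
  · simp
  obtain rfl : β = -α - γ := by linear_combination hsum
  set u : ι → F := fun i => p i - q i with hu
  set v : ι → F := fun i => r i - q i with hv
  have f₁ : ∀ i ∈ I, γ * v i = c₁ - α * u i := by
    intro i hi
    rw [hu, hv]
    linear_combination e₁ i hi
  have f₂ : ∀ i ∈ I, α * u i ^ 2 + γ * v i ^ 2 + 2 * q i * c₁ = c₂ := by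
    intro i hi
    rw [hu, hv]
    linear_combination e₂ i hi - 2 * q i * e₁ i hi
  have f₃ : ∀ i ∈ I, α * u i ^ 3 + γ * v i ^ 3 + 3 * q i * (c₂ - 2 * q i * c₁) +
      3 * q i ^ 2 * c₁ = c₃ := by
    intro i hi
    rw [hu, hv]
    linear_combination e₃ i hi - 3 * q i * e₂ i hi + 3 * q i ^ 2 * e₁ i hi
  have huv : ∀ i ∈ I, ∀ j ∈ I, u i = u j → v i = v j := by
    intro i hi j hj h
    apply mul_left_cancel₀ hγ
    rw [f₁ i hi, f₁ j hj, h]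
  by_cases hc : c₁ = 0
  · subst hc
    have f₄ : ∀ i ∈ I, γ * c₂ = -α * (-α - γ) * u i ^ 2 := by
      intro i hi
      linear_combination -γ * f₂ i hi + (γ * v i - α * u i) * f₁ i hi
    have hc₂ : c₂ ≠ 0 := by
      intro h
      have := f₄ j hj
      rw [h, mul_zero, eq_comm] at this
      exact mul_ne_zero (mul_ne_zero (neg_ne_zero.2 hα) hβ)
        (pow_ne_zero 2 (sub_ne_zero.2 (hpq j hj))) this
    refine card_le_four_of_quartic I u ?_ 0 0 (-α * (-α - γ)) 0 (-(γ * c₂))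
      (Or.inr (mul_ne_zero (neg_ne_zero.2 hα) hβ)) ?_
    · intro i hi j hj h
      have hq : q i = q j := by
        apply mul_left_cancel₀ (mul_ne_zero h3 hc₂)
        have h₁ := f₃ i hi
        have h₂ := f₃ j hj
        rw [h, huv i hi j hj h] at h₁
        linear_combination h₁ - h₂
      exact hp hi hj (by simpa [hu, hq] using h)
    · intro i hi
      linear_combination -f₄ i hi
  · refine card_le_four_of_quartic I u ?_ (-3 * (α * (-α - γ)) ^ 2)
      (-12 * α ^ 2 * (-α - γ) * c₁ + 4 * c₁ * (α * γ ^ 2 - α ^ 3))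
      (6 * α * (-α - γ) * c₁ ^ 2) 0 (c₁ ^ 4 + γ ^ 2 * (3 * c₂ ^ 2 - 4 * c₁ * c₃))
      (Or.inl (mul_ne_zero (neg_ne_zero.2 h3) (pow_ne_zero 2 (mul_ne_zero hα hβ)))) ?_
    · intro i hi j hj h
      have hq : q i = q j := by
        apply mul_left_cancel₀ (mul_ne_zero h2 hc)
        have h₁ := f₂ i hi
        have h₂ := f₂ j hj
        rw [h, huv i hi j hj h] at h₁
        linear_combination h₁ - h₂
      exact hp hi hj (by simpa [hu, hq] using h)
    · intro i hi
      have h₁ : c₁ = γ * v i + α * u i := by linear_combination -f₁ i hi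
      rw [← f₃ i hi, ← f₂ i hi, h₁]
      ring

/-- Weighted power sums along a walk `k₀, k₁, k₂, k₃` determine the nodes up to boundedly many
choices. -/
theorem card_le_four_of_walk (l : Fin 3 → F) (hl : l.Injective)
    (hl' : ∀ i j k, i ≠ j → j ≠ k → i ≠ k → l i + l j ≠ 2 * l k)
    (h2 : (2 : F) ≠ 0) (h3 : (3 : F) ≠ 0) {k₀ k₁ k₂ k₃ : Fin 3} (h₀₁ : k₀ ≠ k₁) (h₁₂ : k₁ ≠ k₂)
    (h₂₃ : k₂ ≠ k₃) (I : Finset ι) (p q r : ι → F) (c₁ c₂ c₃ : F)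
    (hp : Set.InjOn p I) (hr : Set.InjOn r I)
    (hpq : ∀ i ∈ I, p i ≠ q i) (hqr : ∀ i ∈ I, q i ≠ r i)
    (e₁ : ∀ i ∈ I, (l k₁ - l k₀) * p i + (l k₂ - l k₁) * q i + (l k₃ - l k₂) * r i = c₁)
    (e₂ : ∀ i ∈ I,
      (l k₁ - l k₀) * p i ^ 2 + (l k₂ - l k₁) * q i ^ 2 + (l k₃ - l k₂) * r i ^ 2 = c₂)
    (e₃ : ∀ i ∈ I,
      (l k₁ - l k₀) * p i ^ 3 + (l k₂ - l k₁) * q i ^ 3 + (l k₃ - l k₂) * r i ^ 3 = c₃) :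
    I.card ≤ 4 := by
  have hne : ∀ {i j}, i ≠ j → l j - l i ≠ 0 := fun h => sub_ne_zero.2 (hl.ne h.symm)
  have d₁ := hne h₀₁
  have d₂ := hne h₁₂
  have d₃ := hne h₂₃
  -- The walk decides the weights: `k₀ k₁ k₀ k₁` alternates; a single backtrack gives `1, -1, δ`
  -- after scaling, possibly reversed; a closed tour of the three parts has weight sum zero. The
  -- absence of three-term progressions, `hl'`, excludes `δ = -1`.
  by_cases h₀₂ : k₀ = k₂
  · subst h₀₂
    by_cases h₁₃ : k₁ = k₃
    · subst h₁₃
      refine card_le_four_alternating I p q r (c₁ / (l k₁ - l k₀)) (c₂ / (l k₁ - l k₀))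
        (c₃ / (l k₁ - l k₀)) h2 h3 hp hpq hqr ?_ ?_ ?_
      · intro i hi
        rw [← e₁ i hi]; field_simp; ring
      · intro i hi
        rw [← e₂ i hi]; field_simp; ring
      · intro i hi
        rw [← e₃ i hi]; field_simp; ring
    · refine card_le_four_of_sum_ne_zero I p q r ((l k₃ - l k₀) / (l k₁ - l k₀))
        (c₁ / (l k₁ - l k₀)) (c₂ / (l k₁ - l k₀)) (c₃ / (l k₁ - l k₀)) (div_ne_zero d₃ d₁)
        ?_ ?_ hr hpq ?_ ?_ ?_
      · rw [Ne, div_eq_one_iff_eq d₁]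
        exact fun h => h₁₃ (hl (by linear_combination -h))
      · rw [Ne, div_eq_iff d₁]
        exact fun h => hl' k₁ k₃ k₀ h₁₃ h₂₃.symm h₁₂ (by linear_combination h)
      · intro i hi
        rw [← e₁ i hi]; field_simp; ring
      · intro i hi
        rw [← e₂ i hi]; field_simp; ring
      · intro i hi
        rw [← e₃ i hi]; field_simp; ring
  · by_cases h₁₃ : k₁ = k₃
    · subst h₁₃
      refine card_le_four_of_sum_ne_zero I r q p ((l k₁ - l k₀) / (l k₁ - l k₂))
        (c₁ / (l k₁ - l k₂)) (c₂ / (l k₁ - l k₂)) (c₃ / (l k₁ - l k₂)) (div_ne_zero d₁ d₃)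
        ?_ ?_ hp (fun i hi => (hqr i hi).symm) ?_ ?_ ?_
      · rw [Ne, div_eq_one_iff_eq d₃]
        exact fun h => h₀₂ (hl (by linear_combination -h))
      · rw [Ne, div_eq_iff d₃]
        exact fun h => hl' k₀ k₂ k₁ h₀₂ h₂₃ h₀₁ (by linear_combination -h)
      · intro i hi
        rw [← e₁ i hi]; field_simp; ring
      · intro i hi
        rw [← e₂ i hi]; field_simp; ring
      · intro i hi
        rw [← e₃ i hi]; field_simp; ring
    · obtain rfl : k₀ = k₃ := by omega
      exact card_le_four_of_sum_eq_zero I p q r _ _ _ c₁ c₂ c₃ h2 h3 d₁ d₂ d₃ (by ring) hp hpq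
        e₁ e₂ e₃

end PowerSums

/-! ### The moment curve hypergraph. -/

section Construction

variable {F α : Type*} [Field F]

/-- The `k`-th vertex of the hyperedge with parameters `a` and `w`: the point `w + l k • (a, a², a³)`
in the `k`-th part. -/
def momentVertex (l : Fin 3 → F) (a : F) (w : F × F × F) (k : Fin 3) : Fin 3 × F × F × F :=
  (k, w.1 + l k * a, w.2.1 + l k * a ^ 2, w.2.2 + l k * a ^ 3)

/-- The hyperedge with parameters `a` and `w`. -/
def momentEdge (l : Fin 3 → F) (φ : (Fin 3 × F × F × F) ↪ α) (q : F × F × F × F) : Set α :=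
  Set.range fun k => φ (momentVertex l q.1 q.2 k)

/-- The hypergraph whose hyperedges are the triples of points on lines in the directions of the moment
curve, one in each part. -/
def momentHypergraph (l : Fin 3 → F) (φ : (Fin 3 × F × F × F) ↪ α) : Hypergraph α where
  vertexSet := Set.univ
  edgeSet := Set.range (momentEdge l φ)
  subset_vertexSet_of_mem_edgeSet' _ _ := Set.subset_univ _

variable {l : Fin 3 → F} {φ : (Fin 3 × F × F × F) ↪ α}

theorem momentVertex_injective (a : F) (w : F × F × F) :
    (fun k => φ (momentVertex l a w k)).Injective := fun _ _ h =>
  congrArg Prod.fst (φ.injective h)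

theorem eq_of_momentVertex_eq (hl : l.Injective) {i j : Fin 3} (hij : i ≠ j)
    {q q' : F × F × F × F}
    (hi : momentVertex l q.1 q.2 i = momentVertex l q'.1 q'.2 i)
    (hj : momentVertex l q.1 q.2 j = momentVertex l q'.1 q'.2 j) : q = q' := by
  obtain ⟨a, w₁, w₂, w₃⟩ := q
  obtain ⟨a', w₁', w₂', w₃'⟩ := q'
  simp only [momentVertex, Prod.mk.injEq, true_and] at hi hj ⊢
  obtain ⟨hi₁, hi₂, hi₃⟩ := hi
  obtain ⟨hj₁, hj₂, hj₃⟩ := hj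
  have ha : a = a' := by
    apply mul_left_cancel₀ (sub_ne_zero.2 (hl.ne hij))
    linear_combination hi₁ - hj₁
  subst ha
  exact ⟨rfl, add_right_cancel hi₁, add_right_cancel hi₂, add_right_cancel hi₃⟩

theorem eq_of_mem_momentEdge (hl : l.Injective) {u v : α} (huv : u ≠ v) {q q' : F × F × F × F}
    (hu : u ∈ momentEdge l φ q) (hv : v ∈ momentEdge l φ q) (hu' : u ∈ momentEdge l φ q')
    (hv' : v ∈ momentEdge l φ q') : q = q' := by
  obtain ⟨i, rfl⟩ := hu
  obtain ⟨j, rfl⟩ := hv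
  obtain ⟨i', hi⟩ := hu'
  obtain ⟨j', hj⟩ := hv'
  have hi := φ.injective hi
  have hj := φ.injective hj
  obtain rfl : i' = i := congrArg Prod.fst hi
  obtain rfl : j' = j := congrArg Prod.fst hj
  exact eq_of_momentVertex_eq hl (fun h => huv (by rw [h])) hi.symm hj.symm

theorem momentEdge_injective (hl : l.Injective) : (momentEdge l φ).Injective := by
  intro q q' h
  have h0 : (0 : Fin 3) ≠ 1 := by decide
  refine eq_of_mem_momentEdge (φ := φ) hl ((momentVertex_injective q.1 q.2).ne h0)
    ⟨0, rfl⟩ ⟨1, rfl⟩ ?_ ?_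
  · rw [← h]; exact ⟨0, rfl⟩
  · rw [← h]; exact ⟨1, rfl⟩

theorem momentHypergraph_isUniform : IsUniform (momentHypergraph l φ) 3 := by
  rintro _ ⟨q, rfl⟩
  rw [momentEdge, ← Set.image_univ, (momentVertex_injective q.1 q.2).encard_image]
  simp

theorem momentHypergraph_isLinear (hl : l.Injective) : IsLinear (momentHypergraph l φ) := by
  rintro _ ⟨q, rfl⟩ _ ⟨q', rfl⟩ hne
  rw [Set.encard_le_one_iff]
  intro u v hu hv
  by_contra huv
  exact hne (congrArg _ (eq_of_mem_momentEdge hl huv hu.1 hv.1 hu.2 hv.2))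

theorem mem_momentEdge {q : F × F × F × F} {k : Fin 3} {x : F × F × F} :
    φ (k, x) ∈ momentEdge l φ q ↔ (k, x) = momentVertex l q.1 q.2 k := by
  constructor
  · rintro ⟨k', h⟩
    have h := φ.injective h
    obtain rfl : k' = k := congrArg Prod.fst h
    exact h.symm
  · intro h
    exact ⟨k, congrArg φ h.symm⟩

theorem fst_ne_of_mem_momentEdge {q : F × F × F × F} {z z' : Fin 3 × F × F × F} (hz : z ≠ z')
    (h : φ z ∈ momentEdge l φ q) (h' : φ z' ∈ momentEdge l φ q) : z.1 ≠ z'.1 := by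
  obtain ⟨k, x⟩ := z
  obtain ⟨k', x'⟩ := z'
  rintro rfl
  exact hz ((mem_momentEdge.1 h).trans (mem_momentEdge.1 h').symm)

/-- A vertex and a direction determine the hyperedge. -/
theorem momentEdge_fst_ne {q q' : F × F × F × F} {z : Fin 3 × F × F × F}
    (hq : q ≠ q') (h : φ z ∈ momentEdge l φ q) (h' : φ z ∈ momentEdge l φ q') : q.1 ≠ q'.1 := by
  obtain ⟨k, x⟩ := z
  intro ha
  refine hq ?_
  have h := (mem_momentEdge.1 h).symm.trans (mem_momentEdge.1 h')
  obtain ⟨a, w₁, w₂, w₃⟩ := q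
  obtain ⟨a', w₁', w₂', w₃'⟩ := q'
  obtain rfl : a = a' := ha
  simpa [momentVertex] using h

theorem eq_of_fst_eq {q q' : F × F × F × F} {z z₁ z₂ : Fin 3 × F × F × F} (hz : z₁.1 = z₂.1)
    (hq : q.1 = q'.1) (h : φ z ∈ momentEdge l φ q) (h' : φ z ∈ momentEdge l φ q')
    (h₁ : φ z₁ ∈ momentEdge l φ q) (h₂ : φ z₂ ∈ momentEdge l φ q') : z₁ = z₂ := by
  obtain rfl : q = q' := by
    obtain ⟨k, x⟩ := z
    have h := (mem_momentEdge.1 h).symm.trans (mem_momentEdge.1 h')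
    obtain ⟨a, w₁, w₂, w₃⟩ := q
    obtain ⟨a', w₁', w₂', w₃'⟩ := q'
    obtain rfl : a = a' := hq
    simpa [momentVertex] using h
  obtain ⟨k, x⟩ := z₁
  obtain ⟨k', x'⟩ := z₂
  obtain rfl : k = k' := hz
  exact (mem_momentEdge.1 h₁).trans (mem_momentEdge.1 h₂).symm

/-- Pigeonhole on the parts of the two inner vertices: `36 = 9 * 4`, so five paths follow the same
walk through the parts, one more than the power sums allow. -/
theorem momentHypergraph_isFree (hl : l.Injective)
    (hl' : ∀ i j k, i ≠ j → j ≠ k → i ≠ k → l i + l j ≠ 2 * l k)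
    (h2 : (2 : F) ≠ 0) (h3 : (3 : F) ≠ 0) {t : ℕ} (ht : 36 < t) :
    IsFree (bergeTheta α 3 3 t) (momentHypergraph l φ) := by
  rintro K ⟨-, x, y, v, e, hxy, hvx, hvy, hv, he, hve, hKe, -⟩ ⟨-, hsub⟩
  have hedge : ∀ i j, ∃ q, momentEdge l φ q = e i j := fun i j =>
    hsub (hKe ▸ ⟨i, j, rfl⟩)
  choose q hq using hedge
  have hvert : ∀ i j, ∃ z, φ z = v i j := by
    intro i j
    have : ∃ j', v i j ∈ e i j' := by
      induction j using Fin.cases with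
      | zero => exact ⟨0, (hve i 0).1⟩
      | succ j => exact ⟨j, (hve i j).2⟩
    obtain ⟨j', hj'⟩ := this
    rw [← hq] at hj'
    obtain ⟨k, hk⟩ := hj'
    exact ⟨_, hk⟩
  choose z hz using hvert
  have m : ∀ i (j : Fin 3), φ (z i j.castSucc) ∈ momentEdge l φ (q i j) ∧
      φ (z i j.succ) ∈ momentEdge l φ (q i j) := by
    intro i j
    rw [hz, hz, hq]
    exact hve i j
  have hzne : ∀ i (j : Fin 3), z i j.castSucc ≠ z i j.succ := by
    intro i j h
    have := (hv i i j.castSucc j.succ (by rw [← hz, ← hz, h])).1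
    simp [Fin.ext_iff] at this
  have hk : ∀ i (j : Fin 3), (z i j.castSucc).1 ≠ (z i j.succ).1 := fun i j =>
    fst_ne_of_mem_momentEdge (hzne i j) (m i j).1 (m i j).2
  have hqne : ∀ i (j j' : Fin 3), j ≠ j' → q i j ≠ q i j' := by
    intro i j j' hj h
    exact hj (he i i j j' (by rw [← hq, ← hq, h])).2
  have hz0 : ∀ i i', z i 0 = z i' 0 := fun i i' => φ.injective (by rw [hz, hz, hvx, hvx])
  have hz3 : ∀ i i', z i 3 = z i' 3 := fun i i' =>
    φ.injective (by rw [hz, hz]; exact (hvy i).trans (hvy i').symm)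
  have hzinj : ∀ i i' (j : Fin 4), j ≠ 0 → j ≠ 3 → z i j = z i' j → i = i' := by
    intro i i' j h0 hlast h
    rcases (hv i i' j j (by rw [← hz, ← hz, h])).2 with h | h | h
    · exact h
    · exact absurd h h0
    · exact absurd h hlast
  obtain ⟨⟨k₁, k₂⟩, hkk⟩ := Fintype.exists_lt_card_fiber_of_mul_lt_card (n := 4)
    (fun i : Fin t => ((z i 1).1, (z i 2).1)) (by simpa using ht)
  set I := Finset.univ.filter fun i : Fin t => ((z i 1).1, (z i 2).1) = (k₁, k₂) with hI
  have hI₁ : ∀ i ∈ I, (z i 1).1 = k₁ := fun i hi =>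
    congrArg Prod.fst (Finset.mem_filter.1 hi).2
  have hI₂ : ∀ i ∈ I, (z i 2).1 = k₂ := fun i hi =>
    congrArg Prod.snd (Finset.mem_filter.1 hi).2
  obtain ⟨i₀, hi₀⟩ := Finset.card_pos.1 (lt_of_le_of_lt (Nat.zero_le _) hkk)
  obtain ⟨⟨k₀, X₁, X₂, X₃⟩, hX⟩ : ∃ X, z i₀ 0 = X := ⟨_, rfl⟩
  obtain ⟨⟨k₃, Y₁, Y₂, Y₃⟩, hY⟩ : ∃ X, z i₀ 3 = X := ⟨_, rfl⟩
  have coord : ∀ i ∈ I, ∃ V₁ V₂ V₃ W₁ W₂ W₃, z i 0 = (k₀, X₁, X₂, X₃) ∧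
      z i 1 = (k₁, V₁, V₂, V₃) ∧ z i 2 = (k₂, W₁, W₂, W₃) ∧ z i 3 = (k₃, Y₁, Y₂, Y₃) :=
    fun i hi => ⟨_, _, _, _, _, _, (hz0 i i₀).trans hX, Prod.ext (hI₁ i hi) rfl,
      Prod.ext (hI₂ i hi) rfl, (hz3 i i₀).trans hY⟩
  -- A step from part `k` to part `k'` in direction `a` moves the point by `(l k' - l k) • (a, a ^
  -- 2, a ^ 3)`; the three steps telescope.
  have system : ∀ i ∈ I, ((l k₁ - l k₀) * (q i 0).1 + (l k₂ - l k₁) * (q i 1).1 +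
      (l k₃ - l k₂) * (q i 2).1 = Y₁ - X₁) ∧ ((l k₁ - l k₀) * (q i 0).1 ^ 2 +
      (l k₂ - l k₁) * (q i 1).1 ^ 2 + (l k₃ - l k₂) * (q i 2).1 ^ 2 = Y₂ - X₂) ∧
      ((l k₁ - l k₀) * (q i 0).1 ^ 3 + (l k₂ - l k₁) * (q i 1).1 ^ 3 +
      (l k₃ - l k₂) * (q i 2).1 ^ 3 = Y₃ - X₃) := by
    intro i hi
    obtain ⟨V₁, V₂, V₃, W₁, W₂, W₃, h₀, h₁, h₂, h₃⟩ := coord i hi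
    obtain ⟨a₁, a₂⟩ : φ (z i 0) ∈ _ ∧ φ (z i 1) ∈ _ := m i 0
    obtain ⟨b₁, b₂⟩ : φ (z i 1) ∈ _ ∧ φ (z i 2) ∈ _ := m i 1
    obtain ⟨c₁, c₂⟩ : φ (z i 2) ∈ _ ∧ φ (z i 3) ∈ _ := m i 2
    rw [h₀, mem_momentEdge] at a₁
    rw [h₁, mem_momentEdge] at a₂ b₁
    rw [h₂, mem_momentEdge] at b₂ c₁
    rw [h₃, mem_momentEdge] at c₂
    simp only [momentVertex, Prod.mk.injEq, true_and] at a₁ a₂ b₁ b₂ c₁ c₂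
    refine ⟨?_, ?_, ?_⟩
    · linear_combination a₁.1 - a₂.1 + b₁.1 - b₂.1 + c₁.1 - c₂.1
    · linear_combination a₁.2.1 - a₂.2.1 + b₁.2.1 - b₂.2.1 + c₁.2.1 - c₂.2.1
    · linear_combination a₁.2.2 - a₂.2.2 + b₁.2.2 - b₂.2.2 + c₁.2.2 - c₂.2.2
  have hk₀₁ : k₀ ≠ k₁ := by
    have : (z i₀ 0).1 ≠ (z i₀ 1).1 := hk i₀ 0
    rwa [hX, hI₁ _ hi₀] at this
  have hk₁₂ : k₁ ≠ k₂ := by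
    have : (z i₀ 1).1 ≠ (z i₀ 2).1 := hk i₀ 1
    rwa [hI₁ _ hi₀, hI₂ _ hi₀] at this
  have hk₂₃ : k₂ ≠ k₃ := by
    have : (z i₀ 2).1 ≠ (z i₀ 3).1 := hk i₀ 2
    rwa [hY, hI₂ _ hi₀] at this
  refine absurd (card_le_four_of_walk l hl hl' h2 h3 hk₀₁ hk₁₂ hk₂₃ I (fun i => (q i 0).1)
    (fun i => (q i 1).1) (fun i => (q i 2).1) _ _ _ ?_ ?_ ?_ ?_ (fun i hi => (system i hi).1)
    (fun i hi => (system i hi).2.1) (fun i hi => (system i hi).2.2)) (not_le.2 hkk)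
  · intro i hi j hj h
    refine hzinj i j 1 (by decide) (by decide) ?_
    refine eq_of_fst_eq ((hI₁ i hi).trans (hI₁ j hj).symm) h (m i 0).1 ?_ (m i 0).2 (m j 0).2
    have := (m j 0).1
    rwa [show z j (Fin.castSucc 0) = z i (Fin.castSucc 0) from hz0 j i] at this
  · intro i hi j hj h
    refine hzinj i j 2 (by decide) (by decide) ?_
    refine eq_of_fst_eq ((hI₂ i hi).trans (hI₂ j hj).symm) h (m i 2).2 ?_ (m i 2).1 (m j 2).1
    have := (m j 2).2
    rwa [show z j (Fin.succ 2) = z i (Fin.succ 2) from hz3 j i] at this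
  · intro i _
    exact momentEdge_fst_ne (hqne i 0 1 (by decide)) (m i 0).2 (m i 1).1
  · intro i _
    exact momentEdge_fst_ne (hqne i 1 2 (by decide)) (m i 1).2 (m i 2).1

end Construction

/-! ### Choice of the prime and asymptotics. -/

theorem exists_linear_thetaFree {n p : ℕ} (hp : p.Prime) (h5 : 5 < p) (hn : 3 * p ^ 3 ≤ n) {t : ℕ}
    (ht : 36 < t) : ∃ H : Hypergraph (Fin n), H.vertexSet = Set.univ ∧ IsUniform H 3 ∧
      IsLinear H ∧ IsFree (bergeTheta (Fin n) 3 3 t) H ∧ H.edgeSet.ncard = p ^ 4 := by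
  have : Fact p.Prime := ⟨hp⟩
  have hcast : ∀ z : ℤ, z ≠ 0 → z.natAbs ≤ 5 → (z : ZMod p) ≠ 0 := by
    intro z hz hz5 h
    rw [ZMod.intCast_zmod_eq_zero_iff_dvd] at h
    have := Nat.le_of_dvd (Int.natAbs_pos.2 hz) (Int.natCast_dvd.1 h)
    omega
  -- A set without three-term progressions; all quantities that must be nonzero modulo `p` are at
  -- most 5 in absolute value.
  let l : Fin 3 → ℤ := ![0, 1, 3]
  have hl : (fun i => (l i : ZMod p)).Injective := by
    intro i j h
    by_contra hij
    have key : ∀ i j, i ≠ j → l i - l j ≠ 0 ∧ (l i - l j).natAbs ≤ 5 := by decide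
    obtain ⟨h₁, h₂⟩ := key i j hij
    exact hcast _ h₁ h₂ (by push_cast; exact sub_eq_zero.2 h)
  have hl' : ∀ i j k, i ≠ j → j ≠ k → i ≠ k → (l i : ZMod p) + l j ≠ 2 * l k := by
    intro i j k hij hjk hik h
    have key : ∀ i j k, i ≠ j → j ≠ k → i ≠ k →
        l i + l j - 2 * l k ≠ 0 ∧ (l i + l j - 2 * l k).natAbs ≤ 5 := by decide
    obtain ⟨h₁, h₂⟩ := key i j k hij hjk hik
    exact hcast _ h₁ h₂ (by push_cast; exact sub_eq_zero.2 h)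
  obtain ⟨φ⟩ : Nonempty ((Fin 3 × ZMod p × ZMod p × ZMod p) ↪ Fin n) := by
    refine Function.Embedding.nonempty_of_card_le ?_
    simp only [Fintype.card_prod, Fintype.card_fin, ZMod.card]
    exact le_trans (le_of_eq (by ring)) hn
  refine ⟨momentHypergraph (fun i => (l i : ZMod p)) φ, rfl, momentHypergraph_isUniform,
    momentHypergraph_isLinear hl, momentHypergraph_isFree hl hl' ?_ ?_ ht, ?_⟩
  · exact_mod_cast hcast 2 (by decide) (by decide)
  · exact_mod_cast hcast 3 (by decide) (by decide)
  · rw [momentHypergraph, ← Set.image_univ,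
      Set.ncard_image_of_injective _ (momentEdge_injective hl), Set.ncard_univ,
      Nat.card_eq_fintype_card]
    simp only [Fintype.card_prod, ZMod.card]
    ring

theorem exLin_bddAbove (n : ℕ) {t : ℕ} (ht : 0 < t) :
    BddAbove {m : ℕ | ∃ H : Hypergraph (Fin n), H.vertexSet = Set.univ ∧ IsUniform H 3 ∧
      IsLinear H ∧ IsFree (bergeTheta (Fin n) 3 3 t) H ∧ H.edgeSet.ncard = m} := by
  refine ⟨64 * (6 * t + 2) ^ 3 * n ^ 4, ?_⟩
  rintro _ ⟨H, -, hu, hl, hf, rfl⟩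
  exact (Nat.le_self_pow (by decide) _).trans (ncard_edgeSet_pow_three_le ht H hu hl hf)

theorem exLin_pow_three_le (n : ℕ) {t : ℕ} (ht : 0 < t) :
    exLin 3 n (bergeTheta (Fin n) 3 3 t) ^ 3 ≤ 64 * (6 * t + 2) ^ 3 * n ^ 4 := by
  rcases Set.eq_empty_or_nonempty {m : ℕ | ∃ H : Hypergraph (Fin n), H.vertexSet = Set.univ ∧
      IsUniform H 3 ∧ IsLinear H ∧ IsFree (bergeTheta (Fin n) 3 3 t) H ∧ H.edgeSet.ncard = m}
    with h | h
  -- Here `sSup ∅ = 0`.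
  · simp [exLin, h]
  · obtain ⟨H, -, hu, hl, hf, hm⟩ := Nat.sSup_mem h (exLin_bddAbove n ht)
    rw [exLin, ← hm]
    exact ncard_edgeSet_pow_three_le ht H hu hl hf

theorem pow_four_le_exLin_pow_three {n : ℕ} (hn : 3000 ≤ n) {t : ℕ} (ht : 36 < t) :
    n ^ 4 ≤ 192 ^ 4 * exLin 3 n (bergeTheta (Fin n) 3 3 t) ^ 3 := by
  -- Since `24 = 3 * 2 ^ 3`, a prime `p ≤ 2 * m` satisfies `3 * p ^ 3 ≤ n`; since `3000 = 24 * 5 ^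
  -- 3`, `m ≥ 5` and so `p > 5`.
  set m := Nat.findGreatest (fun m => 24 * m ^ 3 ≤ n) n with hm
  have h5 : 5 ≤ m := Nat.le_findGreatest (by omega) (by omega)
  have hmn : 24 * m ^ 3 ≤ n :=
    Nat.findGreatest_spec (P := fun m => 24 * m ^ 3 ≤ n) (m := 5) (by omega) (by omega)
  have hnm : n ≤ 192 * m ^ 3 := by
    have h₁ : n < 24 * (m + 1) ^ 3 := by
      by_contra! h
      have h₂ : m + 1 ≤ n := (Nat.le_self_pow (by decide) _).trans
        ((Nat.le_mul_of_pos_left _ (by decide)).trans h)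
      exact Nat.findGreatest_is_greatest (P := fun m => 24 * m ^ 3 ≤ n) (Nat.lt_succ_self m) h₂ h
    have h₂ : (m + 1) ^ 3 ≤ (2 * m) ^ 3 := by gcongr; omega
    have h₃ : (2 * m) ^ 3 = 8 * m ^ 3 := by ring
    omega
  obtain ⟨p, hp, hmp, hpm⟩ := Nat.exists_prime_lt_and_le_two_mul m (by omega)
  have hpn : 3 * p ^ 3 ≤ n := by
    have h₂ : p ^ 3 ≤ (2 * m) ^ 3 := by gcongr
    have h₃ : (2 * m) ^ 3 = 8 * m ^ 3 := by ring
    omega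
  have hle : p ^ 4 ≤ exLin 3 n (bergeTheta (Fin n) 3 3 t) :=
    le_csSup (exLin_bddAbove n (by omega)) (exists_linear_thetaFree hp (by omega) hpn ht)
  calc n ^ 4 ≤ (192 * m ^ 3) ^ 4 := by gcongr
    _ = 192 ^ 4 * (m ^ 4) ^ 3 := by ring
    _ ≤ 192 ^ 4 * (p ^ 4) ^ 3 := by gcongr
    _ ≤ _ := by gcongr

theorem rpow_four_thirds_pow_three (n : ℕ) : ((n : ℝ) ^ (4 / 3 : ℝ)) ^ 3 = (n : ℝ) ^ 4 := by
  rw [← Real.rpow_natCast, ← Real.rpow_mul (Nat.cast_nonneg n), ← Real.rpow_natCast]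
  norm_num

end LinearTuran

theorem theorem1p3 :
    (fun n : ℕ => (LinearTuran.exLin 3 n (LinearTuran.bergeTheta (Fin n) 3 3 217) : ℝ))
      =Θ[atTop] (fun n : ℕ => (n : ℝ) ^ (4 / 3 : ℝ)) := by
  constructor
  · refine IsBigO.of_bound (64 * (6 * 217 + 2)) (Eventually.of_forall fun n => ?_)
    rw [Real.norm_of_nonneg (by positivity), Real.norm_of_nonneg (by positivity)]
    refine le_of_pow_le_pow_left₀ three_ne_zero (by positivity) ?_
    rw [mul_pow, LinearTuran.rpow_four_thirds_pow_three]
    have h : (_ : ℝ) ≤ _ :=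
      Nat.cast_le.2 (LinearTuran.exLin_pow_three_le n (t := 217) (by norm_num))
    push_cast at h
    refine h.trans ?_
    gcongr
    norm_num
  · refine IsBigO.of_bound (192 ^ 2) ((eventually_ge_atTop 3000).mono fun n hn => ?_)
    rw [Real.norm_of_nonneg (by positivity), Real.norm_of_nonneg (by positivity)]
    refine le_of_pow_le_pow_left₀ three_ne_zero (by positivity) ?_
    rw [mul_pow, LinearTuran.rpow_four_thirds_pow_three]
    have h : (_ : ℝ) ≤ _ :=
      Nat.cast_le.2 (LinearTuran.pow_four_le_exLin_pow_three hn (t := 217) (by norm_num))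
    push_cast at h
    refine h.trans ?_
    gcongr
    norm_num
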